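/- For a real Hilbert space $H$ (of any dimension $\kappa$, finite or infinite) let $\mathbb H_{\mathbf R}^{\kappa}$ denote the real hyperbolic space of $H$: the upper sheet $\{p=(s,u)\in\mathbf R\oplus H : B(p,p)=1,\ s>0\}$ for the form $B((s,u),(t,v))=st-\langle u,v\rangle$, with the metric $\cosh d(p,q)=B(p,q)$. Let $(X_k,o_k)_{k\in J}$ be a family of pointed real hyperbolic spaces (of arbitrary dimensions), let $X'_k\subseteq X_k$ be arbitrary subsets of admissible glueing points, and let $j\in J$. The *free product* $X$ of this family, starting from $X_j$, is the following iterated glueing. A *word* is a non-empty sequence of letters $w_\alpha=(k_\alpha,x_\alpha)$, $x_\alpha\in X_{k_\alpha}$, indexed by the ordinals $\alpha<\theta$ for some countable ordinal $\theta\ge 1$, with $k_0=j$ and such that $x_\alpha\in X'_{k_\alpha}$ and $k_{\alpha+1}\neq k_\alpha$ whenever $\alpha+1<\theta$. (A copy of each $X_l$, $l\ne k$, is glued by $o_l$ at each admissible point of each copy of $X_k$; at each limit point reached at a limit step a copy of every $X_l$ is glued.) Write $|(k,x)|=d(o_k,x)$. The distance of a word to itself is $0$. If $\alpha$ is the first place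 where the words $w\neq w'$ differ (one of them possibly having ended there), then $$d(w,w')=\delta+\sum_{\beta>\alpha}|w_\beta|+\sum_{\beta>\alpha}|w'_\beta|\in[0,\infty],$$ where $\delta=d(x,y)$ if $w_\alpha=(k,x)$ and $w'_\alpha=(k,y)$ have the same index, and $\delta=|w_\alpha|+|w'_\alpha|$ otherwise; letters that are absent contribute $0$. Then $X$ is the metric space obtained from the set of words at finite distance from the original copy of $X_j$ (the one-letter words) by identifying words at distance $0$. **Theorem.** Let $1<\lambda\le e$, let $X$ be a free product of real hyperbolic spaces as above, and let $S\subseteq X$ be any subset with the induced metric (for instance $S=X$). Then there are a real hyperbolic space $\mathbb H_{\mathbf R}^{\kappa}$ (for some cardinal $\kappa$) and a topological embedding $f\colon S\to\mathbb H_{\mathbf R}^{\kappa}$ such that $$\cosh d(f(x),f(y))=\lambda^{d(x,y)}\qquad\text{for all }x,y\in S,$$ and there is a group homomorphism $\rho\colon \mathrm{Isom}(S)\to\mathrm{Isom}(\mathbb H_{\mathbf R}^{\kappa})$ with $f(gx)=\rho(g)f(x)$ for all $g\in\mathrm{Isom}(S)$ and $x\in S$. -/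

import Mathlib

open scoped ENNReal

universe u v

noncomputable section

/-! ### Real hyperbolic spaces of arbitrary dimension -/

/-- The Minkowski form `B (s ⊕ u) (t ⊕ v) = s t - ⟪u, v⟫` on `ℝ ⊕ H`. -/
def minkowskiForm {H : Type v} [NormedAddCommGroup H] [InnerProductSpace ℝ H]
    (p q : ℝ × H) : ℝ :=
  p.1 * q.1 - inner ℝ p.2 q.2

/-- The real hyperbolic space attached to a real Hilbert space `H`, i.e. the space of lines of
positive vectors for the Minkowski form on `ℝ ⊕ H`. Each such line is represented by its unique
vector on the upper sheet of the hyperboloid `B p p = 1`. Its dimension is the Hilbertian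
dimension of `H`, an arbitrary cardinal. -/
@[ext]
structure RealHypSpace (H : Type v) [NormedAddCommGroup H] [InnerProductSpace ℝ H] :
    Type v where
  vec : ℝ × H
  form_self : minkowskiForm vec vec = 1
  time_pos : 0 < vec.1

namespace RealHypSpace

variable {H : Type v} [NormedAddCommGroup H] [InnerProductSpace ℝ H]

/-- `cosh` of the hyperbolic distance. -/
def coshDist (x y : RealHypSpace H) : ℝ := minkowskiForm x.vec y.vec

theorem norm_sq_eq (x : RealHypSpace H) : ‖x.vec.2‖ ^ 2 = x.vec.1 ^ 2 - 1 := by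
  have h := x.form_self
  rw [minkowskiForm, real_inner_self_eq_norm_sq] at h
  linarith

theorem norm_lt (x : RealHypSpace H) : ‖x.vec.2‖ < x.vec.1 :=
  lt_of_pow_lt_pow_left₀ 2 x.time_pos.le (by linarith [x.norm_sq_eq])

theorem coshDist_comm (x y : RealHypSpace H) : coshDist x y = coshDist y x := by
  simp only [coshDist, minkowskiForm, real_inner_comm, mul_comm]

/-- On the orthogonal complement of a point of the hyperboloid, the Minkowski form is negative
semi-definite. -/
theorem form_nonpos (y : RealHypSpace H) (p : ℝ × H) (hp : minkowskiForm p y.vec = 0) :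
    minkowskiForm p p ≤ 0 := by
  have hy := y.norm_lt
  have h1 : p.1 * y.vec.1 = inner ℝ p.2 y.vec.2 := by
    have := hp
    rw [minkowskiForm] at this
    linarith
  have h2 : |p.1| * y.vec.1 ≤ ‖p.2‖ * y.vec.1 := by
    calc |p.1| * y.vec.1 = |p.1 * y.vec.1| := by rw [abs_mul, abs_of_pos y.time_pos]
      _ = |inner ℝ p.2 y.vec.2| := by rw [h1]
      _ ≤ ‖p.2‖ * ‖y.vec.2‖ := abs_real_inner_le_norm _ _
      _ ≤ ‖p.2‖ * y.vec.1 := by gcongr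
  have h3 : |p.1| ≤ ‖p.2‖ := le_of_mul_le_mul_right h2 y.time_pos
  have h4 : p.1 ^ 2 ≤ ‖p.2‖ ^ 2 := by
    rw [← sq_abs p.1]
    gcongr
  rw [minkowskiForm, real_inner_self_eq_norm_sq]
  linarith

theorem form_combo (p q r : ℝ × H) (c : ℝ) :
    minkowskiForm (p - c • q) r = minkowskiForm p r - c * minkowskiForm q r := by
  simp only [minkowskiForm, Prod.fst_sub, Prod.snd_sub, Prod.smul_fst, Prod.smul_snd,
    inner_sub_left, real_inner_smul_left, smul_eq_mul]
  ring

theorem form_comm (p q : ℝ × H) : minkowskiForm p q = minkowskiForm q p := by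
  simp only [minkowskiForm, real_inner_comm, mul_comm]

theorem one_le_coshDist (x y : RealHypSpace H) : 1 ≤ coshDist x y := by
  have h1 : |inner ℝ x.vec.2 y.vec.2| ≤ ‖x.vec.2‖ * ‖y.vec.2‖ := abs_real_inner_le_norm _ _
  have h2 := le_abs_self (inner ℝ x.vec.2 y.vec.2)
  have hx := x.norm_sq_eq
  have hy := y.norm_sq_eq
  have hx' := x.time_pos
  have hy' := y.time_pos
  have h3 : ‖x.vec.2‖ * ‖y.vec.2‖ + 1 ≤ x.vec.1 * y.vec.1 := by
    refine (sq_le_sq₀ (by positivity) (by positivity)).1 ?_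
    have : (x.vec.1 * y.vec.1) ^ 2 = (‖x.vec.2‖ ^ 2 + 1) * (‖y.vec.2‖ ^ 2 + 1) := by
      rw [hx, hy]; ring
    rw [this]
    nlinarith [sq_nonneg (‖x.vec.2‖ - ‖y.vec.2‖)]
  rw [coshDist, minkowskiForm]
  linarith

theorem coshDist_self (x : RealHypSpace H) : coshDist x x = 1 := x.form_self

/-- The reverse Cauchy-Schwarz inequality in the form of the hyperbolic triangle inequality. -/
theorem coshDist_le (x y z : RealHypSpace H) :
    coshDist x z ≤ coshDist x y * coshDist y z +
      √(coshDist x y ^ 2 - 1) * √(coshDist y z ^ 2 - 1) := by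
  set a := coshDist x y with ha
  set b := coshDist y z with hb
  set p : ℝ × H := x.vec - a • y.vec with hp
  set q : ℝ × H := z.vec - b • y.vec with hq
  have hyy : minkowskiForm y.vec y.vec = 1 := y.form_self
  have hxy : minkowskiForm x.vec y.vec = a := rfl
  have hyz : minkowskiForm y.vec z.vec = b := rfl
  have hzy : minkowskiForm z.vec y.vec = b := by rw [form_comm, hyz]
  have hpy : minkowskiForm p y.vec = 0 := by rw [hp, form_combo, hxy, hyy]; ring
  have hqy : minkowskiForm q y.vec = 0 := by rw [hq, form_combo, hzy, hyy]; ring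
  have hpx : minkowskiForm p x.vec = 1 - a ^ 2 := by
    rw [hp, form_combo, x.form_self, form_comm y.vec, hxy]; ring
  have hqz : minkowskiForm q z.vec = 1 - b ^ 2 := by
    rw [hq, form_combo, z.form_self, hyz]; ring
  have hpz : minkowskiForm p z.vec = coshDist x z - a * b := by
    rw [hp, form_combo, hyz]; rfl
  have hpp : minkowskiForm p p = 1 - a ^ 2 := by
    have : minkowskiForm p p = minkowskiForm x.vec p - a * minkowskiForm y.vec p := by
      conv_lhs => rw [hp]
      rw [form_combo]
    rw [this, form_comm x.vec, form_comm y.vec, hpx, hpy]; ring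
  have hqq : minkowskiForm q q = 1 - b ^ 2 := by
    have : minkowskiForm q q = minkowskiForm z.vec q - b * minkowskiForm y.vec q := by
      conv_lhs => rw [hq]
      rw [form_combo]
    rw [this, form_comm z.vec, form_comm y.vec, hqz, hqy]; ring
  have hpq : minkowskiForm q p = coshDist x z - a * b := by
    rw [hq, form_combo, form_comm _ p, form_comm _ p, hpz, hpy]; ring
  have hqp : minkowskiForm p q = coshDist x z - a * b := by rw [form_comm, hpq]
  set c := coshDist x z - a * b with hc
  -- the form is negative semi-definite on the span of `p` and `q`
  have hA : 0 ≤ a ^ 2 - 1 := by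
    have := one_le_coshDist x y
    nlinarith
  have hB : 0 ≤ b ^ 2 - 1 := by
    have := one_le_coshDist y z
    nlinarith
  have key : ∀ t : ℝ, 0 ≤ (b ^ 2 - 1) * (t * t) + (2 * c) * t + (a ^ 2 - 1) := by
    intro t
    have h0 : minkowskiForm (p - t • q) y.vec = 0 := by
      rw [form_combo, hpy, hqy]; ring
    have h1 := form_nonpos y _ h0
    have e1 : minkowskiForm p (p - t • q) = 1 - a ^ 2 - t * c := by
      rw [form_comm, form_combo, hpp, hpq]
    have e2 : minkowskiForm q (p - t • q) = c - t * (1 - b ^ 2) := by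
      rw [form_comm, form_combo, hqq, hqp]
    rw [form_combo, e1, e2] at h1
    nlinarith
  have hdis := discrim_le_zero key
  rw [discrim] at hdis
  have h2 : c ^ 2 ≤ (√(a ^ 2 - 1) * √(b ^ 2 - 1)) ^ 2 := by
    rw [mul_pow, Real.sq_sqrt hA, Real.sq_sqrt hB]
    nlinarith
  have h3 := (le_abs_self c).trans (abs_le_of_sq_le_sq h2 (by positivity))
  linarith

/-- The hyperbolic metric, of curvature `-1`: `cosh (dist x y) = B x y`. -/
instance : MetricSpace (RealHypSpace H) where
  dist x y := Real.arcosh (coshDist x y)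
  dist_self x := by simp [coshDist_self]
  dist_comm x y := by rw [coshDist_comm]
  dist_triangle x y z := by
    have hx := one_le_coshDist x y
    have hy := one_le_coshDist y z
    have hz := one_le_coshDist x z
    have h : coshDist x z ≤
        Real.cosh (Real.arcosh (coshDist x y) + Real.arcosh (coshDist y z)) := by
      rw [Real.cosh_add, Real.cosh_arcosh hx, Real.cosh_arcosh hy, Real.sinh_arcosh hx,
        Real.sinh_arcosh hy]
      exact coshDist_le x y z
    rw [← Real.cosh_arcosh hz, Real.cosh_le_cosh, abs_of_nonneg (Real.arcosh_nonneg hz),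
      abs_of_nonneg (add_nonneg (Real.arcosh_nonneg hx) (Real.arcosh_nonneg hy))] at h
    exact h
  eq_of_dist_eq_zero {x y} h := by
    have h1 : coshDist x y = 1 := (Real.arcosh_eq_zero_iff (one_le_coshDist x y)).1 h
    have hx := x.norm_sq_eq
    have hy := y.norm_sq_eq
    have h2 : inner ℝ x.vec.2 y.vec.2 = x.vec.1 * y.vec.1 - 1 := by
      rw [coshDist, minkowskiForm] at h1
      linarith
    have h3 : ‖x.vec.2 - y.vec.2‖ ^ 2 = (x.vec.1 - y.vec.1) ^ 2 := by
      rw [norm_sub_sq_real, h2, hx, hy]; ring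
    have h4 : x.vec.1 = y.vec.1 := by
      have h5 : |‖x.vec.2‖ - ‖y.vec.2‖| ≤ ‖x.vec.2 - y.vec.2‖ := abs_norm_sub_norm_le _ _
      have hxt := x.time_pos
      have hyt := y.time_pos
      have h8 : x.vec.1 * y.vec.1 - 1 ≤ ‖x.vec.2‖ * ‖y.vec.2‖ := by
        rw [← h2]; exact real_inner_le_norm _ _
      have h7 : 1 ≤ x.vec.1 * y.vec.1 := by nlinarith [sq_nonneg ‖x.vec.2‖, sq_nonneg ‖y.vec.2‖]
      have h9 : (x.vec.1 * y.vec.1 - 1) ^ 2 ≤ (x.vec.1 ^ 2 - 1) * (y.vec.1 ^ 2 - 1) := by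
        rw [← hx, ← hy, ← mul_pow]
        exact pow_le_pow_left₀ (by linarith) h8 2
      have h10 : (x.vec.1 - y.vec.1) ^ 2 ≤ 0 := by nlinarith
      nlinarith [sq_nonneg (x.vec.1 - y.vec.1)]
    have h5 : x.vec.2 = y.vec.2 := by
      rw [h4, sub_self, zero_pow two_ne_zero, sq_eq_zero_iff, norm_eq_zero, sub_eq_zero] at h3
      exact h3
    exact RealHypSpace.ext (Prod.ext h4 h5)

theorem cosh_dist (x y : RealHypSpace H) :
    Real.cosh (dist x y) = minkowskiForm x.vec y.vec :=
  Real.cosh_arcosh (one_le_coshDist x y)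

end RealHypSpace

/-! ### Free products of pointed metric spaces

We are given a family of metric spaces `X k` with base-points `o k` and with sets `A k` of
admissible glueing points, and the index `j` of the original space `X j`.

The spaces attached in the course of the transfinite iterated glueing are described by the route
that leads to them: one travels from the base-point of a copy of some `X k` to an admissible point
`x` of it, continues in the copy of `X l` (`l ≠ k`) that has been attached at that point, and so
on; at limit steps one has arrived at a limit point, at which a copy of each `X k` is attached. The
points are therefore represented by transfinite words `(k_α, x_α)`, of countable ordinal length,
with `x_α` in `X (k_α)`. -/

/-- The set of all countable ordinals. -/
abbrev CountableOrdinal : Type := (Ordinal.omega.{0} 1).ToType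

section FreeProduct

variable {J : Type u} (X : J → Type v) [∀ k, MetricSpace (X k)] (o : ∀ k, X k)

/-- The distance of a letter to the base-point; the missing letter `none` stands for not moving
away from the base-point. -/
def letterNorm : Option (Σ k, X k) → ℝ≥0∞
  | none => 0
  | some ⟨k, x⟩ => edist (o k) x

open Classical in
/-- The distance in the glueing of all the `X k` at their base-points (with `none` representing the
common base-point). -/
def letterEDist : Option (Σ k, X k) → Option (Σ k, X k) → ℝ≥0∞
  | some ⟨k, x⟩, some ⟨l, y⟩ =>
      if h : k = l then edist (h ▸ x) y else edist x (o k) + edist (o l) y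
  | some ⟨k, x⟩, none => edist x (o k)
  | none, some ⟨l, y⟩ => edist (o l) y
  | none, none => 0

/-- Transfinite words describing the points of the iterated glueing, starting in the original copy
of `X j`. The letters form a sequence indexed by an initial segment of the countable ordinals, of
countable length, with `none` at all the later places. -/
@[nolint unusedArguments]
structure GlueWord (_o : ∀ k, X k) (A : ∀ k, Set (X k)) (j : J) : Type (max u v) where
  letter : CountableOrdinal → Option (Σ k, X k)
  /-- the first letter is in the original space -/
  start : ∀ α, IsMin α → ∃ x : X j, letter α = some ⟨j, x⟩
  initial : ∀ α β, α ≤ β → letter α = none → letter β = none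
  bounded : ∃ α, letter α = none
  /-- a copy of `X l` is glued at each admissible point of a copy of `X k` when `l ≠ k` -/
  glue : ∀ α β, α ⋖ β → ∀ k x l y, letter α = some ⟨k, x⟩ → letter β = some ⟨l, y⟩ →
    x ∈ A k ∧ l ≠ k

variable {X o}

theorem letterEDist_self (a : Option (Σ k, X k)) : letterEDist X o a a = 0 := by
  rcases a with _ | ⟨k, x⟩ <;> simp [letterEDist]

theorem letterEDist_comm (a b : Option (Σ k, X k)) :
    letterEDist X o a b = letterEDist X o b a := by
  rcases a with _ | ⟨k, x⟩ <;> rcases b with _ | ⟨l, y⟩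
  · rfl
  · simp [letterEDist, edist_comm]
  · simp [letterEDist, edist_comm]
  · by_cases h : k = l
    · subst h
      simp [letterEDist, edist_comm]
    · simp [letterEDist, h, Ne.symm h, edist_comm, add_comm]

theorem letterEDist_le (a b : Option (Σ k, X k)) :
    letterEDist X o a b ≤ letterNorm X o a + letterNorm X o b := by
  rcases a with _ | ⟨k, x⟩ <;> rcases b with _ | ⟨l, y⟩
  · simp [letterEDist, letterNorm]
  · simp [letterEDist, letterNorm]
  · simp [letterEDist, letterNorm, edist_comm]
  · by_cases h : k = l
    · subst h
      simpa [letterEDist, letterNorm] using edist_triangle_left x y (o k)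
    · simp [letterEDist, letterNorm, h, edist_comm]

theorem letterNorm_le (a b : Option (Σ k, X k)) :
    letterNorm X o a ≤ letterEDist X o a b + letterNorm X o b := by
  rcases a with _ | ⟨k, x⟩ <;> rcases b with _ | ⟨l, y⟩
  · simp [letterEDist, letterNorm]
  · simp [letterNorm]
  · simp [letterEDist, letterNorm, edist_comm]
  · by_cases h : k = l
    · subst h
      simpa [letterEDist, letterNorm, edist_comm, add_comm] using edist_triangle (o k) y x
    · simp only [letterEDist, letterNorm, h, dite_false]
      rw [edist_comm, add_assoc]
      exact le_self_add

theorem letterEDist_triangle (a b c : Option (Σ k, X k)) :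
    letterEDist X o a c ≤ letterEDist X o a b + letterEDist X o b c := by
  rcases b with _ | ⟨l, y⟩
  · refine (letterEDist_le a c).trans (le_of_eq ?_)
    rcases a with _ | ⟨k, x⟩ <;> rcases c with _ | ⟨m, z⟩ <;>
      simp [letterEDist, letterNorm, edist_comm]
  · by_cases ha : ∃ x, a = some ⟨l, x⟩
    · obtain ⟨x, rfl⟩ := ha
      rcases c with _ | ⟨m, z⟩
      · simpa [letterEDist] using edist_triangle x y (o l)
      · by_cases h : l = m
        · subst h
          simpa [letterEDist] using edist_triangle x y z
        · simp only [letterEDist, h, dite_false, dite_true]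
          rw [← add_assoc]
          gcongr
          exact edist_triangle x y (o l)
    · have h1 : letterEDist X o a (some ⟨l, y⟩) =
          letterNorm X o a + letterNorm X o (some ⟨l, y⟩) := by
        rcases a with _ | ⟨k, x⟩
        · simp [letterEDist, letterNorm]
        · have h : k ≠ l := by
            rintro rfl
            exact ha ⟨x, rfl⟩
          simp [letterEDist, letterNorm, h, edist_comm]
      rw [h1]
      refine (letterEDist_le a c).trans ?_
      rw [add_assoc]
      gcongr
      rw [letterEDist_comm, add_comm]
      exact letterNorm_le c _

namespace GlueWord

variable {A : ∀ k, Set (X k)} {j : J}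

open Classical in
/-- The contribution of the place `α` to the distance of two words: as long as they agree, nothing;
at the first place where they differ, their distance in the glueing of all the `X k` attached to
the point reached so far; after that place, they move away from each other in different spaces. -/
def place (u v : GlueWord X o A j) (α : CountableOrdinal) : ℝ≥0∞ :=
  if ∀ β < α, u.letter β = v.letter β then letterEDist X o (u.letter α) (v.letter α)
  else letterNorm X o (u.letter α) + letterNorm X o (v.letter α)

theorem place_self (u : GlueWord X o A j) (α : CountableOrdinal) : place u u α = 0 := by
  simp [place, letterEDist_self]

theorem place_comm (u v : GlueWord X o A j) (α : CountableOrdinal) :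
    place u v α = place v u α := by
  have h : (∀ β < α, u.letter β = v.letter β) ↔ ∀ β < α, v.letter β = u.letter β :=
    forall₂_congr fun _ _ => eq_comm
  unfold place
  by_cases hu : ∀ β < α, u.letter β = v.letter β
  · rw [if_pos hu, if_pos (h.1 hu), letterEDist_comm]
  · rw [if_neg hu, if_neg (fun hv => hu (h.2 hv)), add_comm]

theorem place_le (u v : GlueWord X o A j) (α : CountableOrdinal) :
    place u v α ≤ letterNorm X o (u.letter α) + letterNorm X o (v.letter α) := by
  unfold place
  split_ifs
  · exact letterEDist_le _ _
  · exact le_rfl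

theorem le_place (u v : GlueWord X o A j) (α : CountableOrdinal) :
    letterEDist X o (u.letter α) (v.letter α) ≤ place u v α := by
  unfold place
  split_ifs
  · exact le_rfl
  · exact letterEDist_le _ _

theorem place_triangle (u v w : GlueWord X o A j) (α : CountableOrdinal) :
    place u w α ≤ place u v α + place v w α := by
  by_cases h1 : ∀ β < α, u.letter β = v.letter β
  · by_cases h2 : ∀ β < α, v.letter β = w.letter β
    · have h3 : ∀ β < α, u.letter β = w.letter β := fun β hβ => (h1 β hβ).trans (h2 β hβ)
      rw [place, place, place, if_pos h1, if_pos h2, if_pos h3]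
      exact letterEDist_triangle _ _ _
    · have h4 : place v w α = letterNorm X o (v.letter α) + letterNorm X o (w.letter α) :=
        if_neg h2
      rw [h4, ← add_assoc]
      refine (place_le u w α).trans ?_
      gcongr
      refine (letterNorm_le _ (v.letter α)).trans ?_
      gcongr
      exact le_place u v α
  · have h4 : place u v α = letterNorm X o (u.letter α) + letterNorm X o (v.letter α) :=
      if_neg h1
    rw [h4, add_assoc]
    refine (place_le u w α).trans ?_
    gcongr
    refine (letterNorm_le _ (v.letter α)).trans ?_
    rw [add_comm, letterEDist_comm]
    gcongr
    exact le_place v w α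

/-- The distance (possibly infinite) in the iterated glueing. -/
instance : PseudoEMetricSpace (GlueWord X o A j) where
  edist u v := ∑' α, place u v α
  edist_self u := by simp [place_self]
  edist_comm u v := by simp only [place_comm]
  edist_triangle u v w := by
    rw [← ENNReal.tsum_add]
    exact ENNReal.tsum_le_tsum (place_triangle u v w)

theorem edist_def (u v : GlueWord X o A j) : edist u v = ∑' α, place u v α := rfl

open Classical in
/-- The points of the original copy of `X j`, as words with one single letter. -/
def single (x : X j) : GlueWord X o A j where
  letter α := if IsMin α then some ⟨j, x⟩ else none
  start α hα := ⟨x, if_pos hα⟩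
  initial α β h hα := by
    by_cases h1 : IsMin α
    · simp [h1] at hα
    · have h2 : ¬ IsMin β := fun h2 => h1 (h2.mono h)
      simp [h2]
  bounded := by
    by_contra hne
    push Not at hne
    have hmin : ∀ α : CountableOrdinal, IsMin α := by
      intro α
      by_contra h
      exact hne α (if_neg h)
    have hsub : Subsingleton CountableOrdinal := by
      refine ⟨fun α β => ?_⟩
      rcases le_total α β with h | h
      · exact le_antisymm h (hmin β h)
      · exact le_antisymm (hmin α h) h
    have h1 : Cardinal.mk CountableOrdinal ≤ 1 := Cardinal.le_one_iff_subsingleton.2 hsub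
    rw [Cardinal.mk_toType, Ordinal.card_omega] at h1
    exact absurd (Cardinal.aleph0_le_aleph 1) (not_le.2 (h1.trans_lt Cardinal.one_lt_aleph0))
  glue α β h k x l y hα hβ := by
    have h2 : ¬ IsMin β := fun h2 => (h.lt.not_ge) (h2 h.le)
    simp [h2] at hβ

theorem edist_single (x y : X j) :
    edist (single x : GlueWord X o A j) (single y) = edist x y := by
  have hne : Nonempty CountableOrdinal := by
    rw [Ordinal.nonempty_toType_iff]
    exact (Ordinal.omega_pos 1).ne'
  obtain ⟨m, -, hm⟩ := WellFounded.has_min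
    (wellFounded_lt : WellFounded ((· < ·) : CountableOrdinal → CountableOrdinal → Prop))
    Set.univ Set.univ_nonempty
  have hmin : IsMin m := fun b hb => not_lt.1 (hm b trivial)
  rw [edist_def, tsum_eq_single m]
  · have h : ∀ β < m, (single x : GlueWord X o A j).letter β =
        (single y : GlueWord X o A j).letter β := fun β hβ => absurd hβ (hm β trivial)
    rw [place, if_pos h]
    simp [single, hmin, letterEDist]
  · intro α hα
    have hle : m ≤ α := not_lt.1 (hm α trivial)
    have h : ¬ IsMin α := fun h => hα (le_antisymm (h hle) hle)
    unfold place
    split_ifs <;> simp [single, h, letterEDist, letterNorm]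

end GlueWord

variable (X o)

/-- The words that are at finite distance from the original copy of `X j`. -/
def FiniteGlueWord (A : ∀ k, Set (X k)) (j : J) : Type (max u v) :=
  {w : GlueWord X o A j // ∃ x : X j, edist (GlueWord.single x) w < ⊤}

variable {X o}

theorem FiniteGlueWord.edist_ne_top {A : ∀ k, Set (X k)} {j : J}
    (w w' : FiniteGlueWord X o A j) : edist w.1 w'.1 ≠ ⊤ := by
  obtain ⟨x, hx⟩ := w.2
  obtain ⟨y, hy⟩ := w'.2
  have h : edist w.1 w'.1 ≤ edist w.1 (GlueWord.single x) +
      edist (GlueWord.single x : GlueWord X o A j) (GlueWord.single y) +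
      edist (GlueWord.single y) w'.1 := edist_triangle4 _ _ _ _
  refine ne_top_of_le_ne_top ?_ h
  rw [GlueWord.edist_single, edist_comm w.1]
  exact ENNReal.add_ne_top.2 ⟨ENNReal.add_ne_top.2 ⟨hx.ne, _root_.edist_ne_top x y⟩, hy.ne⟩

instance (A : ∀ k, Set (X k)) (j : J) : PseudoMetricSpace (FiniteGlueWord X o A j) :=
  letI : PseudoEMetricSpace (FiniteGlueWord X o A j) :=
    PseudoEMetricSpace.induced Subtype.val inferInstance
  PseudoEMetricSpace.toPseudoMetricSpace FiniteGlueWord.edist_ne_top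

variable (X o)

/-- The free product of the pointed metric spaces `(X k, o k)`, with admissible glueing points
`A k`, starting from `X j`: words at distance zero from each other represent the same point, which
identifies each glueing point with the base-point of every space attached there. -/
def FreeProduct (A : ∀ k, Set (X k)) (j : J) : Type (max u v) :=
  SeparationQuotient (FiniteGlueWord X o A j)

instance (A : ∀ k, Set (X k)) (j : J) : MetricSpace (FreeProduct X o A j) :=
  inferInstanceAs (MetricSpace (SeparationQuotient (FiniteGlueWord X o A j)))

end FreeProduct

end

/-! Put t = log λ, so 0 < t ≤ 1. A kernel β with β(x,x) = 1 is `cosh` of the distance for some map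
to a hyperbolic space as soon as b(x) b(y) - β(x,y) is positive semi-definite for some b > 0: a
Hilbert space realising this kernel supplies the space components, and b the time components. For β
= exp(t d) take b(x) = exp(t |x|), with |x| the length of a word. Dividing by b(x) b(y) leaves the
kernel 1 - exp(-2t (x|y)), where (x|y) is the Gromov product; its positivity is the whole point.

On one hyperbolic space, the case t = 1 combines e^d = 2 cosh d - e^{-d} with two facts: `cosh` d is
of hyperbolic type (`isPosKernel_coshDist_mul_sub`), and e^{-d} is positive, being a series in odd
powers of 1 / cosh d with non-negative coefficients (`isPosKernel_exp_neg_dist`). Smaller t follow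
from `IsPosKernel.one_sub_rpow`: 1 - (1 - K)^t is a power series in K with non-negative
coefficients. This is where λ ≤ e matters.

On words, the Gromov product is a sum over the places. With K_α the kernel of the place α, 1 - ∏ (1
- K_α) = ∑ K_α ∏_{β<α} (1 - K_β). Since K_α vanishes unless the words agree before α, and on such
words the earlier factors split into a function of u times a function of v, each term is positive
(`FiniteGlueWord.isPosKernel_one_sub_prod`). A limit over finite sets of places handles transfinite
words.

Positivity restricts to any subset S. Finally the image is made total, so that every isometry of S
extends uniquely to a Lorentz operator, and uniqueness makes the extension a homomorphism. -/

/-! ### Positive semi-definite kernels -/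

/-- A real kernel on a set is positive if all the matrices that it defines are positive
semi-definite. -/
def IsPosKernel {X : Type*} (K : X → X → ℝ) : Prop := (Matrix.of K).PosSemidef

namespace IsPosKernel

variable {X Y : Type*} {K L : X → X → ℝ}

theorem iff_symm_nonneg : IsPosKernel K ↔ (∀ x y, K x y = K y x) ∧
    ∀ c : X →₀ ℝ, 0 ≤ ∑ x ∈ c.support, ∑ y ∈ c.support, c x * K x y * c y := by
  constructor
  · rintro ⟨h1, h2⟩
    refine ⟨fun x y => by simpa using h1.apply y x, fun c => ?_⟩
    simpa [Finsupp.sum] using h2 c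
  · rintro ⟨h1, h2⟩
    refine ⟨Matrix.IsHermitian.ext fun x y => by simpa using h1 y x, fun c => ?_⟩
    simpa [Finsupp.sum] using h2 c

theorem symm (h : IsPosKernel K) (x y : X) : K x y = K y x := (iff_symm_nonneg.1 h).1 x y

theorem add (hK : IsPosKernel K) (hL : IsPosKernel L) : IsPosKernel fun x y => K x y + L x y :=
  Matrix.PosSemidef.add hK hL

theorem mul (hK : IsPosKernel K) (hL : IsPosKernel L) : IsPosKernel fun x y => K x y * L x y :=
  Matrix.PosSemidef.hadamard hK hL

theorem comp (hK : IsPosKernel K) (φ : Y → X) : IsPosKernel fun x y => K (φ x) (φ y) :=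
  Matrix.PosSemidef.submatrix hK φ

theorem congr (hK : IsPosKernel K) (h : ∀ x y, L x y = K x y) : IsPosKernel L := by
  rwa [show L = K from funext₂ h]

/-- The quadratic form of the kernel at c is B evaluated on the vector ∑ c(x) φ(x).
Semi-definiteness is asked only on a subspace W so that the indefinite Minkowski form can be used.
-/
theorem of_bilinForm {V : Type*} [AddCommGroup V] [Module ℝ V] (B : LinearMap.BilinForm ℝ V)
    (hB : ∀ v w, B v w = B w v) (W : Submodule ℝ V) (hW : ∀ w ∈ W, 0 ≤ B w w) (φ : X → V)
    (hφ : ∀ x, φ x ∈ W) : IsPosKernel fun x y => B (φ x) (φ y) := by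
  refine iff_symm_nonneg.2 ⟨fun x y => hB _ _, fun c => ?_⟩
  have h := hW (∑ x ∈ c.support, c x • φ x) (W.sum_mem fun x _ => W.smul_mem _ (hφ x))
  simp only [map_sum, LinearMap.sum_apply, map_smul, LinearMap.smul_apply, smul_eq_mul] at h
  refine h.trans_eq (Finset.sum_congr rfl fun x _ => ?_)
  rw [Finset.mul_sum]
  refine Finset.sum_congr rfl fun y _ => ?_
  rw [hB]
  ring

theorem inner {V : Type*} [NormedAddCommGroup V] [InnerProductSpace ℝ V] (φ : X → V) :
    IsPosKernel fun x y => inner ℝ (φ x) (φ y) :=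
  of_bilinForm (innerₗ V) (fun v w => real_inner_comm w v) ⊤
    (fun _ _ => real_inner_self_nonneg) φ fun _ => trivial

theorem mul_self (f : X → ℝ) : IsPosKernel fun x y => f x * f y :=
  (inner f).congr fun x y => by simp [mul_comm]

theorem const {a : ℝ} (ha : 0 ≤ a) : IsPosKernel fun _ _ : X => a :=
  (mul_self fun _ => √a).congr fun _ _ => (Real.mul_self_sqrt ha).symm

theorem const_mul (hK : IsPosKernel K) {a : ℝ} (ha : 0 ≤ a) : IsPosKernel fun x y => a * K x y :=
  (const ha).mul hK

theorem pow (hK : IsPosKernel K) (n : ℕ) : IsPosKernel fun x y => K x y ^ n := by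
  induction n with
  | zero => simpa using const zero_le_one
  | succ n ih => exact (ih.mul hK).congr fun x y => pow_succ _ _

theorem sum {ι : Type*} (s : Finset ι) {K : ι → X → X → ℝ} (hK : ∀ i ∈ s, IsPosKernel (K i)) :
    IsPosKernel fun x y => ∑ i ∈ s, K i x y := by
  classical
  induction s using Finset.induction_on with
  | empty => simpa using const le_rfl
  | insert a s ha ih =>
    refine ((hK a (by simp)).add (ih fun i hi => hK i (by simp [hi]))).congr fun x y => ?_
    rw [Finset.sum_insert ha]

/-- Each condition involves finitely many entries of the kernel, so the cone of positive kernels is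
closed under pointwise limits. -/
theorem of_tendsto {ι : Type*} {l : Filter ι} [l.NeBot] {K : ι → X → X → ℝ}
    (hK : ∀ᶠ i in l, IsPosKernel (K i))
    (h : ∀ x y, Filter.Tendsto (fun i => K i x y) l (nhds (L x y))) : IsPosKernel L := by
  refine iff_symm_nonneg.2 ⟨fun x y => ?_, fun c => ?_⟩
  · refine tendsto_nhds_unique_of_eventuallyEq (h x y) (h y x) ?_
    filter_upwards [hK] with i hi using hi.symm x y
  · refine ge_of_tendsto (tendsto_finsetSum _ fun x _ => tendsto_finsetSum _ fun y _ =>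
      ((h x y).const_mul (c x)).mul_const (c y)) ?_
    filter_upwards [hK] with i hi using (iff_symm_nonneg.1 hi).2 c

theorem of_hasSum {ι : Type*} {K : ι → X → X → ℝ} (hK : ∀ i, IsPosKernel (K i))
    (h : ∀ x y, HasSum (fun i => K i x y) (L x y)) : IsPosKernel L :=
  of_tendsto (.of_forall fun s => sum s fun i _ => hK i) h

theorem of_powerSeries (hK : IsPosKernel K) {a : ℕ → ℝ} (ha : ∀ n, 0 ≤ a n)
    (h : ∀ x y, HasSum (fun n => a n * K x y ^ n) (L x y)) : IsPosKernel L :=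
  of_hasSum (fun n => (hK.pow n).const_mul (ha n)) h

/-- The indicator kernel of an equivalence relation is positive. -/
theorem ite_eq [DecidableEq Y] (r : X → Y) :
    IsPosKernel fun x y => if r x = r y then (1 : ℝ) else 0 := by
  -- A sum, over the classes c, of the rank-one kernels of their indicator functions; only c = r x
  -- can contribute.
  refine of_hasSum (fun c : Y => mul_self fun x => if r x = c then (1 : ℝ) else 0) fun x y => ?_
  convert hasSum_single (r x) fun c hc => ?_ using 1
  · simp [eq_comm]
  · simp [hc.symm]

/-- Moore's theorem: a positive kernel is the Gram kernel of a total family of vectors of a Hilbert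
space. -/
theorem exists_hilbert {X : Type u} {K : X → X → ℝ} (hK : IsPosKernel K) :
    ∃ (H : Type u) (_ : NormedAddCommGroup H) (_ : InnerProductSpace ℝ H) (_ : CompleteSpace H)
      (φ : X → H), (∀ x y, Inner.inner ℝ (φ x) (φ y) = K x y) ∧
        (Submodule.span ℝ (Set.range φ)).topologicalClosure = ⊤ := by
  -- The reproducing kernel space takes operator-valued kernels, so scalars become multiples of the
  -- identity of ℝ.
  let M : Matrix X X (ℝ →L[ℝ] ℝ) := .of fun x y => K x y • ContinuousLinearMap.id ℝ ℝ
  have hM : M.PosSemidef := by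
    have htfae := (RKHS.posSemidef_tfae (K := M)).out 0 2
    refine htfae.2 ⟨?_, fun c => ?_⟩
    · ext x y : 1
      rw [Matrix.conjTranspose_apply]
      have : M y x = M x y := by simp only [M, Matrix.of_apply, hK.symm x y]
      rw [this, ContinuousLinearMap.star_eq_adjoint]
      refine ContinuousLinearMap.ext fun a => ext_inner_right ℝ fun b => ?_
      rw [ContinuousLinearMap.adjoint_inner_left]
      simp [M]
      ring
    · refine ((iff_symm_nonneg.1 hK).2 c).trans_eq ?_
      simp only [Finsupp.sum, RCLike.re_to_real]
      refine Finset.sum_congr rfl fun x _ => Finset.sum_congr rfl fun y _ => ?_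
      simp [M, hK.symm x y]
      ring
  have : Fact M.PosSemidef := ⟨hM⟩
  refine ⟨RKHS.OfKernel M, inferInstance, inferInstance, inferInstance,
    fun x => RKHS.kerFun (RKHS.OfKernel M) x 1, fun x y => ?_, ?_⟩
  · rw [RKHS.kerFun_inner, RKHS.kerFun_apply, RKHS.OfKernel.kernel_ofKernel]
    simp [M]
  · rw [← RKHS.kerFun_dense (RKHS.OfKernel M)]
    congr 1
    refine le_antisymm (Submodule.span_mono ?_) (Submodule.span_le.2 ?_)
    · rintro _ ⟨x, rfl⟩
      exact ⟨x, 1, rfl⟩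
    · rintro _ ⟨x, a, rfl⟩
      have : RKHS.kerFun (RKHS.OfKernel M) x a = a • RKHS.kerFun (RKHS.OfKernel M) x 1 := by
        rw [← map_smul, smul_eq_mul, mul_one]
      rw [this]
      exact Submodule.smul_mem _ _ (Submodule.subset_span ⟨x, rfl⟩)

/-- A Schur complement: the Gram kernel of the vectors after projecting away from the unit vector at
o. -/
theorem sub_mul (hK : IsPosKernel K) {o : X} (ho : K o o = 1) :
    IsPosKernel fun x y => K x y - K x o * K y o := by
  obtain ⟨H, _, _, _, φ, hφ, -⟩ := hK.exists_hilbert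
  refine (inner fun x => φ x - K x o • φ o).congr fun x y => ?_
  simp only [inner_sub_left, inner_sub_right, real_inner_smul_left, real_inner_smul_right, hφ, ho,
    hK.symm o y]
  ring

end IsPosKernel

/-! ### Fractional powers of positive kernels -/

/-- The power series of `1 - (1 - x) ^ t` has non-negative coefficients if `0 ≤ t ≤ 1`. -/
theorem exists_hasSum_one_sub_rpow {t : ℝ} (ht : 0 ≤ t) (ht' : t ≤ 1) :
    ∃ a : ℕ → ℝ, (∀ n, 0 ≤ a n) ∧
      ∀ x : ℝ, |x| < 1 → HasSum (fun n => a n * x ^ (n + 1)) (1 - (1 - x) ^ t) := by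
  refine ⟨fun n => (-1) ^ n * Ring.choose t (n + 1), fun n => ?_, fun x hx => ?_⟩
  · have hrec : ∀ n : ℕ, ((n : ℝ) + 1) * Ring.choose t (n + 1) = Ring.choose t n * (t - n) := by
      intro n
      rw [Ring.choose_eq_smul, Ring.choose_eq_smul, descPochhammer_succ_right,
        Polynomial.smeval_mul, Nat.factorial_succ]
      simp [Polynomial.smeval_natCast]
      field_simp
    induction n with
    | zero => simpa using ht
    | succ n ih =>
      have h := hrec (n + 1)
      push_cast at h
      -- The ratio of consecutive coefficients is (n + 1 - t) / (n + 2), non-negative because t ≤ 1;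
      -- the first coefficient is t itself.
      have h1 : (-1) ^ (n + 1) * Ring.choose t (n + 1 + 1) =
          (-1) ^ n * Ring.choose t (n + 1) * ((n + 1 - t) / (n + 1 + 1)) := by
        field_simp
        rw [pow_succ]
        linear_combination (- (-1) ^ n) * h
      simp only [h1]
      have : (0 : ℝ) ≤ n := n.cast_nonneg
      exact mul_nonneg ih (div_nonneg (by linarith) (by linarith))
  · have h := (Real.one_add_rpow_hasFPowerSeriesOnBall_zero (a := t)).hasSum (y := -x)
      (by simpa [enorm_eq_nnnorm, ← NNReal.coe_lt_coe] using hx)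
    simp only [binomialSeries_apply, List.ofFn_const, List.prod_replicate, smul_eq_mul,
      zero_add] at h
    have h1 := ((hasSum_nat_add_iff' 1).2 h).neg
    have e1 : ∀ n, (-1) ^ n * Ring.choose t (n + 1) * x ^ (n + 1) =
        -(Ring.choose t (n + 1) * (-x) ^ (n + 1)) := by
      intro n
      rw [neg_pow x, pow_succ (-1 : ℝ)]
      ring
    have e2 : 1 - (1 - x) ^ t =
        -((1 + -x) ^ t - ∑ i ∈ Finset.range 1, Ring.choose t i * (-x) ^ i) := by
      simp [sub_eq_add_neg]
    simp only [e1, e2]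
    exact h1

theorem IsPosKernel.one_sub_rpow {X : Type*} {K : X → X → ℝ} (hK : IsPosKernel K)
    (h : ∀ x y, |K x y| < 1) {t : ℝ} (ht : 0 ≤ t) (ht' : t ≤ 1) :
    IsPosKernel fun x y => 1 - (1 - K x y) ^ t := by
  obtain ⟨a, ha, hs⟩ := exists_hasSum_one_sub_rpow ht ht'
  exact of_hasSum (fun n => (hK.pow (n + 1)).const_mul (ha n)) fun x y => hs _ (h x y)

/-! ### Positive kernels on real hyperbolic spaces -/

namespace RealHypSpace

variable {H : Type v} [NormedAddCommGroup H] [InnerProductSpace ℝ H]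

/-- The Minkowski form as a bilinear form. -/
def minkowskiBilin (H : Type v) [NormedAddCommGroup H] [InnerProductSpace ℝ H] :
    LinearMap.BilinForm ℝ (ℝ × H) :=
  LinearMap.mk₂ ℝ minkowskiForm
    (fun p q r => by simp only [minkowskiForm, Prod.fst_add, Prod.snd_add, inner_add_left]; ring)
    (fun c p q => by
      simp only [minkowskiForm, Prod.smul_fst, Prod.smul_snd, real_inner_smul_left, smul_eq_mul]
      ring)
    (fun p q r => by simp only [minkowskiForm, Prod.fst_add, Prod.snd_add, inner_add_right]; ring)
    (fun c p q => by
      simp only [minkowskiForm, Prod.smul_fst, Prod.smul_snd, real_inner_smul_right, smul_eq_mul]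
      ring)

theorem minkowskiBilin_apply (p q : ℝ × H) : minkowskiBilin H p q = minkowskiForm p q := rfl

/-- Up to sign this is the Minkowski form of the projections to the orthogonal complement of o,
where the form is negative semi-definite. -/
theorem isPosKernel_coshDist_mul_sub (o : RealHypSpace H) :
    IsPosKernel fun x y : RealHypSpace H =>
      coshDist x o * coshDist y o - coshDist x y := by
  refine (IsPosKernel.of_bilinForm (-minkowskiBilin H)
    (fun v w => congrArg Neg.neg (form_comm v w)) (LinearMap.ker ((minkowskiBilin H).flip o.vec))
    (fun w hw => ?_) (fun x => x.vec - coshDist x o • o.vec) fun x => ?_).congr fun x y => ?_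
  · exact neg_nonneg.2 (form_nonpos o w hw)
  · have h : minkowskiForm (x.vec - coshDist x o • o.vec) o.vec = 0 := by
      rw [form_combo, o.form_self, mul_one]
      exact sub_self _
    exact h
  · rw [LinearMap.neg_apply, LinearMap.neg_apply, minkowskiBilin_apply, form_combo,
      form_comm x.vec, form_comm o.vec, form_combo, form_combo, o.form_self, form_comm o.vec,
      form_comm y.vec]
    simp only [coshDist]
    ring

/-- In the Klein model, with points u/s in the open unit ball, the kernel is a rank-one factor times
the geometric series of an inner product of absolute value less than 1. -/
theorem isPosKernel_inv_coshDist :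
    IsPosKernel fun x y : RealHypSpace H => (coshDist x y)⁻¹ := by
  have hlt : ∀ x : RealHypSpace H, ‖x.vec.1⁻¹ • x.vec.2‖ < 1 := fun x => by
    rw [norm_smul, norm_inv, Real.norm_of_nonneg x.time_pos.le, inv_mul_lt_one₀ x.time_pos]
    exact x.norm_lt
  have hK : IsPosKernel fun x y : RealHypSpace H =>
      (1 - inner ℝ (x.vec.1⁻¹ • x.vec.2) (y.vec.1⁻¹ • y.vec.2))⁻¹ := by
    refine (IsPosKernel.inner fun x : RealHypSpace H => x.vec.1⁻¹ • x.vec.2).of_powerSeries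
      (a := fun _ => 1) (fun _ => zero_le_one) fun x y => ?_
    simp only [one_mul]
    refine hasSum_geometric_of_abs_lt_one ((abs_real_inner_le_norm _ _).trans_lt ?_)
    exact mul_lt_one_of_nonneg_of_lt_one_left (norm_nonneg _) (hlt x) (hlt y).le
  refine ((IsPosKernel.mul_self fun x : RealHypSpace H => x.vec.1⁻¹).mul hK).congr fun x y => ?_
  have hx := x.time_pos.ne'
  have hy := y.time_pos.ne'
  rw [← mul_inv, ← mul_inv, real_inner_smul_left, real_inner_smul_right, coshDist, minkowskiForm]
  congr 1
  field_simp

theorem coshDist_eq_cosh (x y : RealHypSpace H) : coshDist x y = Real.cosh (dist x y) :=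
  (cosh_dist x y).symm

/-- With c = cosh d one has e^{-d} = c (1 - √(1 - c⁻²)), a series in the odd powers of the positive
kernel c⁻¹ with non-negative coefficients. On the diagonal c⁻² = 1 is on the boundary of the disc of
convergence, so c⁻² is replaced by r c⁻² and r tends to 1 from below. -/
theorem isPosKernel_exp_neg_dist :
    IsPosKernel fun x y : RealHypSpace H => Real.exp (-dist x y) := by
  obtain ⟨a, ha, hs⟩ := exists_hasSum_one_sub_rpow (t := 1 / 2) (by norm_num) (by norm_num)
  have hlim : ∀ x y : RealHypSpace H, Filter.Tendsto
      (fun r : ℝ => coshDist x y * (1 - (1 - r * (coshDist x y)⁻¹ ^ 2) ^ (1 / 2 : ℝ)))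
      (nhdsWithin 1 (Set.Ioo 0 1)) (nhds (Real.exp (-dist x y))) := by
    intro x y
    have hcont : Continuous fun r : ℝ =>
        coshDist x y * (1 - (1 - r * (coshDist x y)⁻¹ ^ 2) ^ (1 / 2 : ℝ)) := by
      have h : Continuous fun s : ℝ => s ^ (1 / 2 : ℝ) :=
        Real.continuous_rpow_const (by norm_num)
      fun_prop
    have hval : coshDist x y * (1 - (1 - 1 * (coshDist x y)⁻¹ ^ 2) ^ (1 / 2 : ℝ)) =
        Real.exp (-dist x y) := by
      have hc := Real.cosh_pos (dist x y)
      have hsq : 1 - 1 * (Real.cosh (dist x y))⁻¹ ^ 2 =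
          (Real.sinh (dist x y) / Real.cosh (dist x y)) ^ 2 := by
        field_simp
        linarith [Real.cosh_sq (dist x y)]
      rw [coshDist_eq_cosh, hsq, ← Real.sqrt_eq_rpow, Real.sqrt_sq
        (div_nonneg (Real.sinh_nonneg_iff.2 dist_nonneg) hc.le), mul_sub, mul_one,
        mul_div_cancel₀ _ hc.ne', Real.cosh_sub_sinh]
    rw [← hval]
    exact hcont.continuousWithinAt
  have : (nhdsWithin (1 : ℝ) (Set.Ioo 0 1)).NeBot := right_nhdsWithin_Ioo_neBot zero_lt_one
  refine IsPosKernel.of_tendsto ?_ hlim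
  filter_upwards [self_mem_nhdsWithin] with r hr
  refine IsPosKernel.of_hasSum (K := fun n x y => a n * r ^ (n + 1) *
    (coshDist x y)⁻¹ ^ (2 * n + 1)) (fun n => (isPosKernel_inv_coshDist.pow _).const_mul
      (mul_nonneg (ha n) (pow_nonneg hr.1.le _))) fun x y => ?_
  have hc : 1 ≤ coshDist x y := one_le_coshDist x y
  have hc0 : coshDist x y ≠ 0 := by positivity
  have h1 : (coshDist x y)⁻¹ ^ 2 ≤ 1 := pow_le_one₀ (by positivity) (inv_le_one_of_one_le₀ hc)
  have h2 : |r * (coshDist x y)⁻¹ ^ 2| < 1 := by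
    rw [abs_of_nonneg (mul_nonneg hr.1.le (by positivity))]
    exact mul_lt_one_of_nonneg_of_lt_one_left hr.1.le hr.2 h1
  have e : ∀ n, a n * r ^ (n + 1) * (coshDist x y)⁻¹ ^ (2 * n + 1) =
      coshDist x y * (a n * (r * (coshDist x y)⁻¹ ^ 2) ^ (n + 1)) := fun n => ?_
  · simp only [e]
    exact (hs _ h2).mul_left (coshDist x y)
  rw [mul_pow, ← pow_mul, show 2 * (n + 1) = 2 * n + 1 + 1 by ring, pow_succ _ (2 * n + 1)]
  field_simp

/-- Substituting e^d = 2 cosh d - e^{-d} splits the kernel into three positive ones: twice the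
`cosh` kernel relative to o, the kernel of e^{-d} projected away from o, and twice the rank-one
kernel of sinh d(·,o). -/
theorem isPosKernel_exp_dist_mul_sub (o : RealHypSpace H) :
    IsPosKernel fun x y : RealHypSpace H =>
      Real.exp (dist x o) * Real.exp (dist y o) - Real.exp (dist x y) := by
  have h1 := (isPosKernel_coshDist_mul_sub o).const_mul (zero_le_two (α := ℝ))
  have h2 := (isPosKernel_exp_neg_dist (H := H)).sub_mul (o := o) (by simp)
  have h3 := (IsPosKernel.mul_self fun x : RealHypSpace H =>
    Real.sinh (dist x o)).const_mul (zero_le_two (α := ℝ))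
  refine ((h1.add h2).add h3).congr fun x y => ?_
  have h : ∀ a b : RealHypSpace H, Real.exp (dist a b) =
      2 * Real.cosh (dist a b) - Real.exp (-dist a b) := fun a b => by
    rw [← Real.cosh_add_sinh, ← Real.cosh_sub_sinh]; ring
  have h' : ∀ a b : RealHypSpace H, Real.sinh (dist a b) =
      Real.cosh (dist a b) - Real.exp (-dist a b) := fun a b => by
    rw [← Real.cosh_sub_sinh]; ring
  simp only [coshDist_eq_cosh, h, h']
  ring

/-- The kernel `1 - exp (-2 t (x|y))`, where `(x|y)` is the Gromov product. -/
theorem isPosKernel_one_sub_exp (o : RealHypSpace H) {t : ℝ} (ht : 0 ≤ t) (ht' : t ≤ 1) :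
    IsPosKernel fun x y : RealHypSpace H =>
      1 - Real.exp (-(t * (dist o x + dist o y - dist x y))) := by
  have h1 := (IsPosKernel.mul_self fun x : RealHypSpace H => Real.exp (-dist o x)).mul
    (isPosKernel_exp_dist_mul_sub o)
  have h2 : IsPosKernel fun x y : RealHypSpace H =>
      1 - Real.exp (-(dist o x + dist o y - dist x y)) := by
    refine h1.congr fun x y => ?_
    rw [dist_comm x o, dist_comm y o, mul_sub, ← Real.exp_add, ← Real.exp_add, ← Real.exp_add,
      ← Real.exp_add]
    rw [show -dist o x + -dist o y + (dist o x + dist o y) = 0 by ring, Real.exp_zero]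
    ring_nf
  refine (h2.one_sub_rpow (fun x y => ?_) ht ht').congr fun x y => ?_
  · have h3 : Real.exp (-(dist o x + dist o y - dist x y)) ≤ 1 :=
      Real.exp_le_one_iff.2 (by linarith [dist_triangle_left x y o])
    rw [abs_lt]
    constructor <;> linarith [Real.exp_pos (-(dist o x + dist o y - dist x y))]
  · rw [sub_sub_cancel, ← Real.exp_mul]
    ring_nf

end RealHypSpace

/-! ### Positive kernels on free products -/

noncomputable section

variable {J : Type u} {X : J → Type v} [∀ k, MetricSpace (X k)] {o : ∀ k, X k}

theorem letterNorm_ne_top (a : Option (Σ k, X k)) : letterNorm X o a ≠ ⊤ := by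
  rcases a with _ | ⟨k, x⟩
  · simp [letterNorm]
  · exact edist_ne_top _ _

variable (o) in
/-- Twice the Gromov product of two letters with respect to the common base-point. -/
def letterGromov (a b : Option (Σ k, X k)) : ℝ :=
  (letterNorm X o a).toReal + (letterNorm X o b).toReal - (letterEDist X o a b).toReal

variable (o) in
open Classical in
/-- The nearest point to a letter in the space with index `k`. -/
def letterProj (k : J) : Option (Σ k, X k) → X k
  | none => o k
  | some ⟨l, x⟩ => if h : l = k then h ▸ x else o k

/-- In a wedge, letters from different factors have Gromov product 0, so the kernel is the sum over
k of the kernels pulled back along the projections to X k, at most one of which is non-zero at a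
given pair. -/
theorem isPosKernel_letter {t : ℝ} (h : ∀ k, IsPosKernel fun x y : X k =>
    1 - Real.exp (-(t * (dist (o k) x + dist (o k) y - dist x y)))) :
    IsPosKernel fun a b : Option (Σ k, X k) => 1 - Real.exp (-(t * letterGromov o a b)) := by
  refine IsPosKernel.of_hasSum (fun k => (h k).comp (letterProj o k)) fun a b => ?_
  rcases a with _ | ⟨k, x⟩
  · have h0 : letterGromov o none b = 0 := by
      rcases b with _ | ⟨l, y⟩ <;> simp [letterGromov, letterNorm, letterEDist]
    simp [h0, letterProj]
  · convert hasSum_single k fun l hl => ?_ using 1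
    · rcases b with _ | ⟨l, y⟩
      · simp [letterProj, letterGromov, letterNorm, letterEDist, edist_dist, dist_comm]
      · by_cases hkl : k = l
        · subst hkl
          simp [letterProj, letterGromov, letterNorm, letterEDist, edist_dist]
        · have hlk : l ≠ k := Ne.symm hkl
          simp [letterProj, letterGromov, letterNorm, letterEDist, edist_dist, hkl, hlk,
            ENNReal.toReal_add, dist_comm]
    · simp [letterProj, hl.symm]

/-! ### The Gromov product of words, place by place -/

namespace FiniteGlueWord

variable {A : ∀ k, Set (X k)} {j : J}

/-- The length of the path from the base-point that is described by a word. -/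
def length (w : FiniteGlueWord X o A j) : ℝ :=
  ∑' α, (letterNorm X o (w.1.letter α)).toReal

theorem tsum_letterNorm_ne_top (w : FiniteGlueWord X o A j) :
    ∑' α, letterNorm X o (w.1.letter α) ≠ ⊤ := by
  -- The one-letter word at the base-point: all its letters have norm 0, so the length of w is
  -- bounded by its finite distance to w₀.
  let w₀ : FiniteGlueWord X o A j :=
    ⟨GlueWord.single (o j), o j, by rw [edist_self]; exact ENNReal.zero_lt_top⟩
  have h0 : ∀ α, letterNorm X o (w₀.1.letter α) = 0 := fun α => by
    by_cases h : IsMin α <;> simp [w₀, GlueWord.single, h, letterNorm]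
  refine ne_top_of_le_ne_top (edist_ne_top w w₀) (ENNReal.tsum_le_tsum fun α => ?_)
  refine (letterNorm_le _ (w₀.1.letter α)).trans ?_
  rw [h0, add_zero]
  exact GlueWord.le_place _ _ α

theorem hasSum_length (w : FiniteGlueWord X o A j) :
    HasSum (fun α => (letterNorm X o (w.1.letter α)).toReal) w.length :=
  ENNReal.hasSum_toReal w.tsum_letterNorm_ne_top

theorem hasSum_dist (u v : FiniteGlueWord X o A j) :
    HasSum (fun α => (GlueWord.place u.1 v.1 α).toReal) (dist u v) := by
  have h := edist_ne_top u v
  rw [GlueWord.edist_def] at h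
  have h1 : dist u v = ∑' α, (GlueWord.place u.1 v.1 α).toReal := by
    rw [← ENNReal.tsum_toReal_eq fun α => ENNReal.ne_top_of_tsum_ne_top h α]
    rfl
  rw [h1]
  exact ENNReal.hasSum_toReal h

/-- The contribution of the place `α` to twice the Gromov product of two words. -/
def gromovPlace (u v : FiniteGlueWord X o A j) (α : CountableOrdinal) : ℝ :=
  (letterNorm X o (u.1.letter α)).toReal + (letterNorm X o (v.1.letter α)).toReal -
    (GlueWord.place u.1 v.1 α).toReal

theorem gromovPlace_of_agree {u v : FiniteGlueWord X o A j} {α : CountableOrdinal}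
    (h : ∀ β < α, u.1.letter β = v.1.letter β) :
    gromovPlace u v α = letterGromov o (u.1.letter α) (v.1.letter α) := by
  rw [gromovPlace, GlueWord.place, if_pos h, letterGromov]

theorem gromovPlace_of_not_agree {u v : FiniteGlueWord X o A j} {α : CountableOrdinal}
    (h : ¬ ∀ β < α, u.1.letter β = v.1.letter β) : gromovPlace u v α = 0 := by
  rw [gromovPlace, GlueWord.place, if_neg h,
    ENNReal.toReal_add (letterNorm_ne_top _) (letterNorm_ne_top _), sub_self]

theorem gromovPlace_of_eq {u v : FiniteGlueWord X o A j} {α : CountableOrdinal}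
    (h : ∀ β ≤ α, u.1.letter β = v.1.letter β) :
    gromovPlace u v α =
      (letterNorm X o (u.1.letter α)).toReal + (letterNorm X o (v.1.letter α)).toReal := by
  rw [gromovPlace_of_agree fun β hβ => h β hβ.le, letterGromov, h α le_rfl, letterEDist_self,
    ENNReal.toReal_zero, sub_zero]

-- The product telescopes along the order of the places, each term carrying the kernel at α and the
-- factors at β < α. The term is the indicator that the words agree before α, times the letter
-- kernel at α, times a rank-one kernel: where the words agree, the Gromov contribution of β is
-- |u_β| + |v_β|, whose exponential splits.
open Classical in
theorem isPosKernel_one_sub_prod {t : ℝ} (h : ∀ k, IsPosKernel fun x y : X k =>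
    1 - Real.exp (-(t * (dist (o k) x + dist (o k) y - dist x y))))
    (s : Finset CountableOrdinal) :
    IsPosKernel fun u v : FiniteGlueWord X o A j =>
      1 - ∏ α ∈ s, Real.exp (-(t * gromovPlace u v α)) := by
  have hterm : ∀ α ∈ s, IsPosKernel fun u v : FiniteGlueWord X o A j =>
      (1 - Real.exp (-(t * gromovPlace u v α))) *
        ∏ β ∈ s with β < α, (1 - (1 - Real.exp (-(t * gromovPlace u v β)))) := by
    intro α _
    -- Agreement before α is equality of the truncated words, hence an equivalence relation with
    -- positive indicator kernel.
    let r (u : FiniteGlueWord X o A j) (β : Set.Iio α) := u.1.letter β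
    have h1 := IsPosKernel.ite_eq r
    have h2 := (isPosKernel_letter h).comp fun u : FiniteGlueWord X o A j => u.1.letter α
    have h3 := IsPosKernel.mul_self fun u : FiniteGlueWord X o A j =>
      ∏ β ∈ s with β < α, Real.exp (-(t * (letterNorm X o (u.1.letter β)).toReal))
    refine ((h1.mul h2).mul h3).congr fun u v => ?_
    by_cases hag : ∀ β < α, u.1.letter β = v.1.letter β
    · have hr : r u = r v := funext fun β => hag β.1 β.2
      rw [if_pos hr, one_mul, gromovPlace_of_agree hag,
        ← Finset.prod_mul_distrib]
      refine congrArg _ (Finset.prod_congr rfl fun β hβ => ?_)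
      rw [sub_sub_cancel, ← Real.exp_add, gromovPlace_of_eq fun γ hγ =>
        hag γ (hγ.trans_lt (Finset.mem_filter.1 hβ).2)]
      ring_nf
    · have hr : r u ≠ r v := fun h => hag fun β hβ => congrFun h ⟨β, hβ⟩
      rw [if_neg hr, gromovPlace_of_not_agree hag]
      simp
  refine (IsPosKernel.sum s hterm).congr fun u v => ?_
  have := Finset.prod_one_sub_ordered s fun α => 1 - Real.exp (-(t * gromovPlace u v α))
  rw [← sub_sub_cancel 1 (∑ α ∈ s, _), ← this]
  simp only [sub_sub_cancel]

/-- If the kernels `1 - exp (-2 t (x|y))`, where `(x|y)` is the Gromov product, are positive on all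
the factors, then also on the free product. -/
theorem isPosKernel_one_sub_exp {t : ℝ} (h : ∀ k, IsPosKernel fun x y : X k =>
    1 - Real.exp (-(t * (dist (o k) x + dist (o k) y - dist x y)))) :
    IsPosKernel fun u v : FiniteGlueWord X o A j =>
      1 - Real.exp (-(t * (u.length + v.length - dist u v))) := by
  refine IsPosKernel.of_tendsto (l := Filter.atTop)
    (.of_forall fun s => isPosKernel_one_sub_prod h s) fun u v => ?_
  have hs : HasSum (fun α => -(t * gromovPlace u v α)) (-(t * (u.length + v.length - dist u v))) :=
    (((u.hasSum_length.add v.hasSum_length).sub (u.hasSum_dist v)).mul_left t).neg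
  simp only [← Real.exp_sum]
  exact ((Real.continuous_exp.tendsto _).comp hs).const_sub 1

theorem isPosKernel_exp_length_sub {t : ℝ} (h : ∀ k, IsPosKernel fun x y : X k =>
    1 - Real.exp (-(t * (dist (o k) x + dist (o k) y - dist x y)))) :
    IsPosKernel fun u v : FiniteGlueWord X o A j =>
      Real.exp (t * u.length) * Real.exp (t * v.length) - Real.exp (t * dist u v) := by
  refine ((IsPosKernel.mul_self fun u : FiniteGlueWord X o A j =>
    Real.exp (t * u.length)).mul (isPosKernel_one_sub_exp h)).congr fun u v => ?_
  rw [mul_sub, mul_one, ← Real.exp_add, ← Real.exp_add]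
  ring_nf

end FiniteGlueWord

end

/-! ### Total maps to hyperbolic spaces and equivariance -/

namespace RealHypSpace

variable {H : Type v} [NormedAddCommGroup H] [InnerProductSpace ℝ H]

theorem continuous_minkowskiForm :
    Continuous fun p : (ℝ × H) × (ℝ × H) => minkowskiForm p.1 p.2 := by
  unfold minkowskiForm
  fun_prop

theorem abs_minkowskiForm_le (p q : ℝ × H) : |minkowskiForm p q| ≤ 2 * ‖q‖ * ‖p‖ := by
  have h1 : |p.1 * q.1| ≤ ‖p‖ * ‖q‖ := by
    rw [abs_mul]
    exact mul_le_mul (norm_fst_le p) (norm_fst_le q) (abs_nonneg _) (norm_nonneg _)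
  have h2 : |inner ℝ p.2 q.2| ≤ ‖p‖ * ‖q‖ := (abs_real_inner_le_norm _ _).trans
    (mul_le_mul (norm_snd_le p) (norm_snd_le q) (norm_nonneg _) (norm_nonneg _))
  have h3 := abs_sub (p.1 * q.1) (inner ℝ p.2 q.2)
  rw [minkowskiForm]
  linarith

/-- Points of opposite sheets pair non-positively, so a positive pairing with one upper point
detects the upper sheet. -/
theorem time_pos_of_form_pos {p : ℝ × H} (hp : minkowskiForm p p = 1) (y : RealHypSpace H)
    (hy : 0 < minkowskiForm p y.vec) : 0 < p.1 := by
  by_contra! hneg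
  have h1 : ‖p.2‖ ^ 2 = p.1 ^ 2 - 1 := by
    rw [minkowskiForm, real_inner_self_eq_norm_sq] at hp
    linarith
  have h2 : ‖p.2‖ ≤ -p.1 := by
    refine (sq_le_sq₀ (norm_nonneg _) (by linarith)).1 ?_
    rw [h1]
    nlinarith
  have h3 := (abs_le.1 (abs_real_inner_le_norm p.2 y.vec.2)).1
  have h4 : ‖p.2‖ * ‖y.vec.2‖ ≤ -p.1 * y.vec.1 :=
    mul_le_mul h2 y.norm_lt.le (norm_nonneg _) (by linarith)
  rw [minkowskiForm] at hy
  linarith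

/-- A linear map preserving the Minkowski form acts on the hyperbolic space as soon as it preserves
the upper sheet. -/
def map (T : ℝ × H →L[ℝ] ℝ × H) (hT : ∀ p q, minkowskiForm (T p) (T q) = minkowskiForm p q)
    (x y : RealHypSpace H) (hxy : T x.vec = y.vec) (z : RealHypSpace H) : RealHypSpace H where
  vec := T z.vec
  form_self := (hT _ _).trans z.form_self
  time_pos := time_pos_of_form_pos ((hT _ _).trans z.form_self) y <| by
    rw [← hxy, hT]
    exact zero_lt_one.trans_le (one_le_coshDist z x)

/-- A map to a hyperbolic space with prescribed distances, from a positive kernel. -/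
def ofKernel {S : Type*} {β : S → S → ℝ} {b : S → ℝ} (hb : ∀ x, 0 < b x) (hβ : ∀ x, β x x = 1)
    {φ : S → H} (hφ : ∀ x y, inner ℝ (φ x) (φ y) = b x * b y - β x y) (x : S) :
    RealHypSpace H where
  vec := (b x, φ x)
  form_self := by rw [minkowskiForm, hφ, hβ, sub_sub_cancel]
  time_pos := hb x

theorem coshDist_ofKernel {S : Type*} {β : S → S → ℝ} {b : S → ℝ} (hb : ∀ x, 0 < b x)
    (hβ : ∀ x, β x x = 1) {φ : S → H} (hφ : ∀ x y, inner ℝ (φ x) (φ y) = b x * b y - β x y)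
    (x y : S) : coshDist (ofKernel hb hβ hφ x) (ofKernel hb hβ hφ y) = β x y := by
  rw [coshDist, minkowskiForm]
  simp only [ofKernel]
  rw [hφ, sub_sub_cancel]

/-- A kernel `β` with one positive direction comes from a map to a hyperbolic space, which can be
chosen to be total and to map a given point to the origin. -/
theorem exists_total_map {S : Type u} {β : S → S → ℝ} {b : S → ℝ} (hb : ∀ x, 0 < b x)
    (hβ : ∀ x, β x x = 1) (hK : IsPosKernel fun x y => b x * b y - β x y) (x₀ : S) :
    ∃ (H : Type u) (_ : NormedAddCommGroup H) (_ : InnerProductSpace ℝ H) (_ : CompleteSpace H)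
      (f : S → RealHypSpace H), (∀ x y, coshDist (f x) (f y) = β x y) ∧ (f x₀).vec = (1, 0) ∧
        (Submodule.span ℝ (Set.range fun x => (f x).vec)).topologicalClosure = ⊤ := by
  -- A first realisation, with the given b, serves only to show that b may be replaced by β(·, x₀).
  -- The second one, with this new b, puts x₀ at the origin.
  obtain ⟨H₁, _, _, _, φ₁, hφ₁, -⟩ := hK.exists_hilbert
  have hcosh := coshDist_ofKernel hb hβ hφ₁
  have hb₀ : ∀ x, 0 < β x x₀ := fun x => by
    rw [← hcosh]
    exact zero_lt_one.trans_le (one_le_coshDist _ _)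
  have hK₀ : IsPosKernel fun x y => β x x₀ * β y x₀ - β x y :=
    ((isPosKernel_coshDist_mul_sub (ofKernel hb hβ hφ₁ x₀)).comp (ofKernel hb hβ hφ₁)).congr
      fun x y => by simp only [hcosh]
  obtain ⟨H, _, _, _, φ, hφ, hd⟩ := hK₀.exists_hilbert
  have hφ₀ : φ x₀ = 0 := by
    rw [← inner_self_eq_zero (𝕜 := ℝ), hφ, hβ]
    norm_num
  have hvec₀ : (ofKernel hb₀ hβ hφ x₀).vec = (1, 0) := Prod.ext (hβ x₀) hφ₀
  refine ⟨H, _, _, inferInstance, ofKernel hb₀ hβ hφ, coshDist_ofKernel hb₀ hβ hφ, hvec₀, ?_⟩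
  set W := (Submodule.span ℝ (Set.range fun x => (ofKernel hb₀ hβ hφ x).vec)).topologicalClosure
    with hW
  have hmem : ∀ x, (ofKernel hb₀ hβ hφ x).vec ∈ W := fun x =>
    Submodule.le_topologicalClosure _ (Submodule.subset_span ⟨x, rfl⟩)
  have h1 : ((1, 0) : ℝ × H) ∈ W := hvec₀ ▸ hmem x₀
  -- Subtracting a multiple of the origin (1, 0) from the image of x leaves (0, φ x), and the
  -- vectors φ x are total in H.
  have h2 : W.comap (LinearMap.inr ℝ ℝ H) = ⊤ := by
    rw [eq_top_iff, ← hd]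
    refine Submodule.topologicalClosure_minimal _ (Submodule.span_le.2 ?_) ?_
    · rintro _ ⟨x, rfl⟩
      have h3 : ((0, φ x) : ℝ × H) = (ofKernel hb₀ hβ hφ x).vec - β x x₀ • (1, 0) := by
        simp [ofKernel]
      change ((0, φ x) : ℝ × H) ∈ W
      rw [h3]
      exact W.sub_mem (hmem x) (W.smul_mem _ h1)
    · exact (Submodule.isClosed_topologicalClosure _).preimage (Continuous.prodMk_right 0)
  rw [eq_top_iff]
  rintro ⟨a, w⟩ -
  have h4 : ((0, w) : ℝ × H) ∈ W := by
    have : w ∈ W.comap (LinearMap.inr ℝ ℝ H) := h2 ▸ Submodule.mem_top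
    exact this
  have h5 : ((a, w) : ℝ × H) = a • ((1, 0) : ℝ × H) + (0, w) := by simp
  rw [h5]
  exact W.add_mem (W.smul_mem _ h1) h4

/-! ### Extending symmetries to Lorentz operators -/

section Equivariance

variable {S : Type u} {f : S → RealHypSpace H}

/-- Permutations preserving the distances of the points of a total family extend to linear maps
preserving the Minkowski form. -/
theorem exists_extension [CompleteSpace H] {x₀ : S} (h₀ : (f x₀).vec = (1, 0))
    (hd : (Submodule.span ℝ (Set.range fun x => (f x).vec)).topologicalClosure = ⊤)
    (g : S ≃ S) (hg : ∀ x y, coshDist (f (g x)) (f (g y)) = coshDist (f x) (f y)) :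
    ∃ T : ℝ × H →L[ℝ] ℝ × H, (∀ p q, minkowskiForm (T p) (T q) = minkowskiForm p q) ∧
      ∀ x, T (f x).vec = (f (g x)).vec := by
  let e := Finsupp.linearCombination ℝ fun x => (f x).vec
  let e' := Finsupp.linearCombination ℝ fun x => (f (g x)).vec
  have hB : ∀ c d, minkowskiForm (e' c) (e' d) = minkowskiForm (e c) (e d) := by
    have h : (minkowskiBilin H).compl₁₂ e' e' = (minkowskiBilin H).compl₁₂ e e := by
      ext x y
      simpa [e, e', minkowskiBilin_apply, coshDist] using hg x y
    exact fun c d => LinearMap.congr_fun₂ h c d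
  have hdense : DenseRange e := by
    have h : (Set.range e : Set (ℝ × H)) = Submodule.span ℝ (Set.range fun x => (f x).vec) := by
      rw [← Finsupp.range_linearCombination]
      rfl
    rw [DenseRange, h, dense_iff_closure_eq, ← Submodule.topologicalClosure_coe, hd]
    rfl
  set q := (f (g.symm x₀)).vec with hq
  -- Preserving an indefinite form does not give boundedness by itself. Here the time component of
  -- the image is its pairing with (1, 0), the image of the vector q attached to g⁻¹ x₀, so it
  -- equals the pairing of the original vector with q; the space component is then controlled by the
  -- invariance of the form.
  have hnorm : ∀ c, ‖e' c‖ ≤ (2 * ‖q‖ + 2) * ‖e c‖ := by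
    intro c
    have h1 : (e' c).1 = minkowskiForm (e c) q := by
      have h2 := hB c (Finsupp.single (g.symm x₀) 1)
      simpa [e, e', h₀, minkowskiForm, hq] using h2
    have h2 : |(e' c).1| ≤ 2 * ‖q‖ * ‖e c‖ := h1 ▸ abs_minkowskiForm_le _ _
    have h3 : ‖(e' c).2‖ ^ 2 = (e' c).1 ^ 2 - minkowskiForm (e c) (e c) := by
      rw [← hB, minkowskiForm, real_inner_self_eq_norm_sq]
      ring
    have h4 := (abs_le.1 (abs_minkowskiForm_le (e c) (e c))).1
    have h5 : (e' c).1 ^ 2 ≤ (2 * ‖q‖ * ‖e c‖) ^ 2 := sq_le_sq' (abs_le.1 h2).1 (abs_le.1 h2).2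
    have h6 : 0 ≤ ‖q‖ * (‖e c‖ * ‖e c‖) := by positivity
    refine (Prod.norm_def _).trans_le (max_le (h2.trans ?_) ?_)
    · linarith [norm_nonneg (e c)]
    · refine (sq_le_sq₀ (norm_nonneg _) (by positivity)).1 ?_
      rw [h3]
      nlinarith [norm_nonneg (e c)]
  let T : ℝ × H →L[ℝ] ℝ × H := e'.extendOfNorm e
  have hT : ∀ c, T (e c) = e' c := LinearMap.extendOfNorm_eq hdense ⟨_, hnorm⟩
  refine ⟨T, fun p q => ?_, fun x => ?_⟩
  · refine hdense.induction_on₂ (p := fun p q => minkowskiForm (T p) (T q) = minkowskiForm p q)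
      ?_ (fun c d => ?_) p q
    · exact isClosed_eq (continuous_minkowskiForm.comp
        ((T.continuous.comp continuous_fst).prodMk (T.continuous.comp continuous_snd)))
        continuous_minkowskiForm
    · rw [hT, hT, hB]
  · simpa [e, e'] using hT (Finsupp.single x 1)

theorem extension_unique
    (hd : (Submodule.span ℝ (Set.range fun x => (f x).vec)).topologicalClosure = ⊤)
    {T T' : ℝ × H →L[ℝ] ℝ × H} (h : ∀ x, T (f x).vec = T' (f x).vec) : T = T' := by
  refine ContinuousLinearMap.ext_on (s := Set.range fun x => (f x).vec) ?_ ?_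
  · rw [dense_iff_closure_eq, ← Submodule.topologicalClosure_coe, hd]
    rfl
  · rintro _ ⟨x, rfl⟩
    exact h x

theorem exists_equivariant_hom [CompleteSpace H] {G : Type*} [Group G] [MulAction G S] {x₀ : S}
    (h₀ : (f x₀).vec = (1, 0))
    (hd : (Submodule.span ℝ (Set.range fun x => (f x).vec)).topologicalClosure = ⊤)
    (hG : ∀ (g : G) x y, coshDist (f (g • x)) (f (g • y)) = coshDist (f x) (f y)) :
    ∃ ρ : G →* (RealHypSpace H ≃ᵢ RealHypSpace H), ∀ g x, f (g • x) = ρ g (f x) := by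
  choose T hT hTf using fun g : G =>
    exists_extension h₀ hd (MulAction.toPerm g) fun x y => hG g x y
  have hone : T 1 = ContinuousLinearMap.id ℝ _ := extension_unique hd fun x => by simp [hTf]
  have hmul : ∀ g h, T (g * h) = (T g).comp (T h) := fun g h =>
    extension_unique hd fun x => by simp [hTf, mul_smul]
  let M (g : G) := map (T g) (hT g) (f x₀) (f (g • x₀)) (hTf g x₀)
  have hMone : ∀ z, M 1 z = z := fun z => RealHypSpace.ext (by simp [M, map, hone])
  have hMmul : ∀ g h z, M (g * h) z = M g (M h z) := fun g h z =>
    RealHypSpace.ext (by simp [M, map, hmul])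
  let ρ (g : G) : RealHypSpace H ≃ᵢ RealHypSpace H :=
    { toFun := M g
      invFun := M g⁻¹
      left_inv := fun z => by rw [← hMmul, inv_mul_cancel, hMone]
      right_inv := fun z => by rw [← hMmul, mul_inv_cancel, hMone]
      isometry_toFun := Isometry.of_dist_eq fun y z => congrArg Real.arcosh (hT g y.vec z.vec) }
  refine ⟨{ toFun := ρ, map_one' := ?_, map_mul' := fun g h => ?_ }, fun g x => ?_⟩
  · exact IsometryEquiv.ext hMone
  · exact IsometryEquiv.ext (hMmul g h)
  · exact RealHypSpace.ext (hTf g x).symm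

end Equivariance

/-- Each of the two distances is a continuous function of the other, vanishing at 0. -/
theorem isEmbedding_of_cosh_dist {S : Type*} [MetricSpace S] {t : ℝ} (ht : 0 < t)
    {f : S → RealHypSpace H}
    (hf : ∀ x y, Real.cosh (dist (f x) (f y)) = Real.exp (t * dist x y)) :
    Topology.IsEmbedding f := by
  have hdist : ∀ x y, dist x y = Real.log (Real.cosh (dist (f x) (f y))) / t := fun x y => by
    rw [hf, Real.log_exp, mul_div_cancel_left₀ _ ht.ne']
  have hdist' : ∀ x y, dist (f x) (f y) = Real.arcosh (Real.exp (t * dist x y)) := fun x y => by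
    rw [← hf, Real.arcosh_cosh dist_nonneg]
  refine ⟨Topology.isInducing_iff_nhds.2 fun a => le_antisymm ?_ ?_, fun x y hxy => ?_⟩
  · rw [← Filter.tendsto_iff_comap, tendsto_iff_dist_tendsto_zero]
    have h : Filter.Tendsto (fun x => Real.exp (t * dist x a)) (nhds a)
        (nhdsWithin 1 (Set.Ici 1)) := by
      refine tendsto_nhdsWithin_iff.2 ⟨?_, .of_forall fun x =>
        Real.one_le_exp (mul_nonneg ht.le dist_nonneg)⟩
      have hc : Continuous fun x => Real.exp (t * dist x a) := by fun_prop
      simpa using hc.tendsto a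
    have h1 := (Real.continuousOn_arcosh 1 Set.self_mem_Ici).tendsto.comp h
    simpa [hdist', Function.comp_def] using h1
  · rw [← Filter.tendsto_id']
    rw [tendsto_iff_dist_tendsto_zero]
    have h : Continuous fun s : ℝ => Real.log (Real.cosh s) / t :=
      (Real.continuous_cosh.log fun s => (Real.cosh_pos s).ne').div_const t
    have h1 : Filter.Tendsto (fun x => dist (f x) (f a)) (Filter.comap f (nhds (f a))) (nhds 0) :=
      tendsto_iff_dist_tendsto_zero.1 Filter.tendsto_comap
    have h2 := (h.tendsto 0).comp h1
    simpa [hdist, Function.comp_def] using h2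
  · rw [← dist_eq_zero, hdist, hxy, dist_self]
    simp

theorem exists_equivariant_embedding {S : Type u} [MetricSpace S] {t : ℝ} (ht : 0 < t) {b : S → ℝ}
    (hb : ∀ x, 0 < b x) (hK : IsPosKernel fun x y => b x * b y - Real.exp (t * dist x y)) :
    ∃ (H : Type u) (_ : NormedAddCommGroup H) (_ : InnerProductSpace ℝ H) (_ : CompleteSpace H)
      (f : S → RealHypSpace H), Topology.IsEmbedding f ∧
      (∀ x y, Real.cosh (dist (f x) (f y)) = Real.exp (t * dist x y)) ∧
      ∃ ρ : (S ≃ᵢ S) →* (RealHypSpace H ≃ᵢ RealHypSpace H),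
        ∀ (g : S ≃ᵢ S) (x : S), f (g x) = ρ g (f x) := by
  rcases isEmpty_or_nonempty S with hS | ⟨⟨x₀⟩⟩
  -- Without a point to put at the origin, any Hilbert space will do.
  · obtain ⟨H, _, _, _, -⟩ := hK.exists_hilbert
    exact ⟨H, inferInstance, inferInstance, inferInstance, isEmptyElim, .of_subsingleton _,
      fun x => isEmptyElim x, 1, fun _ x => isEmptyElim x⟩
  · obtain ⟨H, _, _, _, f, hf, h₀, hd⟩ := exists_total_map hb (by simp) hK x₀
    have hf' : ∀ x y, Real.cosh (dist (f x) (f y)) = Real.exp (t * dist x y) := fun x y => by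
      rw [← coshDist_eq_cosh, hf]
    let act : MulAction (S ≃ᵢ S) S :=
      { smul := fun g x => g x
        one_smul := fun _ => rfl
        mul_smul := fun _ _ _ => rfl }
    refine ⟨H, _, _, inferInstance, f, isEmbedding_of_cosh_dist ht hf', hf',
      exists_equivariant_hom (G := S ≃ᵢ S) h₀ hd fun g x y => ?_⟩
    rw [hf, hf]
    exact congrArg (fun s => Real.exp (t * s)) (g.dist_eq x y)

end RealHypSpace

/-- The result for the free product itself is the case `S = Set.univ`; other subsets `S`, with the
induced metric, cover the variants of the iterated glueing with fewer copies or fewer steps. -/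
theorem theorem8p6 {J : Type u} (E : J → Type v) [∀ k, NormedAddCommGroup (E k)]
    [∀ k, InnerProductSpace ℝ (E k)] [∀ k, CompleteSpace (E k)]
    (o : ∀ k, RealHypSpace (E k)) (A : ∀ k, Set (RealHypSpace (E k))) (j : J)
    (S : Set (FreeProduct (fun k => RealHypSpace (E k)) o A j))
    (lam : ℝ) (hlam : 1 < lam) (hlam' : lam ≤ Real.exp 1) :
    ∃ (H : Type (max u v)) (_ : NormedAddCommGroup H) (_ : InnerProductSpace ℝ H)
      (_ : CompleteSpace H) (f : S → RealHypSpace H),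
      Topology.IsEmbedding f ∧
      (∀ x y : S, Real.cosh (dist (f x) (f y)) = lam ^ dist x y) ∧
      ∃ ρ : (S ≃ᵢ S) →* (RealHypSpace H ≃ᵢ RealHypSpace H),
        ∀ (g : S ≃ᵢ S) (x : S), f (g x) = ρ g (f x) := by
  have ht : 0 < Real.log lam := Real.log_pos hlam
  have ht' : Real.log lam ≤ 1 := (Real.log_le_iff_le_exp (zero_lt_one.trans hlam)).2 hlam'
  have hsurj : Function.Surjective (SeparationQuotient.mk :
      FiniteGlueWord (fun k => RealHypSpace (E k)) o A j → _) := SeparationQuotient.surjective_mk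
  -- A choice of representing words preserves distances, so the kernel on words pulls back to S.
  let r (x : S) : FiniteGlueWord (fun k => RealHypSpace (E k)) o A j :=
    Function.surjInv hsurj x.1
  have hr : ∀ x y : S, dist (r x) (r y) = dist x y := fun x y => by
    have hmk : ∀ z : S, SeparationQuotient.mk (r z) = z.1 := fun z => Function.surjInv_eq hsurj _
    rw [← SeparationQuotient.dist_mk, hmk, hmk]
    rfl
  have hK := (FiniteGlueWord.isPosKernel_exp_length_sub (A := A) (j := j) fun k =>
    RealHypSpace.isPosKernel_one_sub_exp (o k) ht.le ht').comp r
  simp only [hr] at hK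
  obtain ⟨H, _, _, _, f, hf, hdist, hρ⟩ :=
    RealHypSpace.exists_equivariant_embedding ht (fun _ => Real.exp_pos _) hK
  refine ⟨H, _, _, inferInstance, f, hf, fun x y => ?_, hρ⟩
  rw [hdist, Real.rpow_def_of_pos (zero_lt_one.trans hlam)]
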